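/- Let $K$ be a field of characteristic $0$, $R=K[x_1,\dots,x_n]$, and $I\subseteq R$ an ideal. For a maximal ideal $\mathfrak m$ of a polynomial ring $S=F[y_1,\dots,y_e]$ over a field $F$ of characteristic $0$, with residue field $\kappa(\mathfrak m)=S/\mathfrak m$, let $\kappa(\mathfrak m)\langle\partial_y\rangle$ be the $\kappa(\mathfrak m)$-vector space of operators $D=\sum_\alpha c_\alpha\partial_y^\alpha$ (finite sums, $c_\alpha\in\kappa(\mathfrak m)$), and for $g\in S$ put $D\cdot[g]=\sum_\alpha c_\alpha\,[\partial_y^\alpha g]\in\kappa(\mathfrak m)$, where $[\,\cdot\,]$ is the class modulo $\mathfrak m$. For an ideal $J\subseteq S$ define the local dual space $D_{\mathfrak m}[J]=\{D : D\cdot[g]=0 \text{ for all } g\in J\}$ and the excess dual space $E_{\mathfrak m}[J]=D_{\mathfrak m}[J]/D_{\mathfrak m}[J:\mathfrak m^\infty]$, where $J:\mathfrak m^\infty=\bigcup_k (J:\mathfrak m^k)$. Suppose that for each associated prime $\mathfrak p\in\operatorname{Ass}(R/I)$ we are given 1. a regular system of parameters $t\sqcup y$ of $R$ (polynomials $t_1,\dots,t_d,y_1,\dots,y_e\in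 R$ such that $R=K[t,y]$ is the polynomial ring in them) such that $t$ are free variables for $\mathfrak p$, i.e. the cosets of $t_1,\dots,t_d$ form a maximal algebraically independent family (a transcendence basis) in $R/\mathfrak p$ over $K$; write $R(t)=K(t)\otimes_{K[t]}R=K(t)[y]$, and $\mathfrak p(t)$, $I(t)$ for the extensions of $\mathfrak p$, $I$ to $R(t)$ (then $\mathfrak p(t)$ is maximal); 2. a finite set of differential operators $A_{\mathfrak p}\subseteq D_{\mathfrak p(t)}[I(t)]\subseteq\kappa(\mathfrak p(t))\langle\partial_y\rangle$ whose cosets span $E_{\mathfrak p(t)}[I(t)]$ over $\kappa(\mathfrak p(t))$. Then a polynomial $f\in R$ belongs to $I$ if and only if $$D\cdot[f]=0\in\kappa(\mathfrak p(t))\qquad\text{for each }\mathfrak p\in\operatorname{Ass}(R/I)\text{ and each }D\in A_{\mathfrak p}.$$ -/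

import Mathlib

namespace LocalDual

open MvPolynomial

/-! ### Local dual spaces over `F[y₁, …, yₑ]` -/

section Local

variable {F : Type*} [Field F] {e : ℕ}

/-- The operator `∂^α = ∂₁^α₁ ⋯ ∂ₑ^αₑ` on `F[y₁, …, yₑ]`, as a product of (commuting)
endomorphisms. -/
noncomputable def partialMonomial (α : Fin e →₀ ℕ) : Module.End F (MvPolynomial (Fin e) F) :=
  (List.ofFn fun i : Fin e =>
    ((pderiv i : Derivation F (MvPolynomial (Fin e) F) (MvPolynomial (Fin e) F)) :
      MvPolynomial (Fin e) F →ₗ[F] MvPolynomial (Fin e) F) ^ α i).prod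

/-- The residue ring `κ(m) = F[y] / m` (the residue field when `m` is maximal). -/
def ResidueAt (m : Ideal (MvPolynomial (Fin e) F)) : Type _ :=
  MvPolynomial (Fin e) F ⧸ m

noncomputable instance (m : Ideal (MvPolynomial (Fin e) F)) : CommRing (ResidueAt m) :=
  Ideal.Quotient.commRing m

/-- The quotient map `g ↦ [g]` from `F[y]` to `κ(m)`. -/
noncomputable def residue (m : Ideal (MvPolynomial (Fin e) F)) :
    MvPolynomial (Fin e) F →+* ResidueAt m :=
  Ideal.Quotient.mk m

/-- The local differential space `κ(m)⟨∂_y⟩ = κ(m) ⊗ W`, where `W = F[y]⟨∂_y⟩` is the Weyl algebra.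
As a left `F[y]`-module `W` is free on the monomials `∂^α`, so `κ(m)⟨∂_y⟩` is the free left
`κ(m)`-module on the `∂^α`: the finitely supported `D` stands for `∑ α, D α ∂^α`. -/
def LocalDiffSpace (m : Ideal (MvPolynomial (Fin e) F)) : Type _ :=
  (Fin e →₀ ℕ) →₀ ResidueAt m

noncomputable instance (m : Ideal (MvPolynomial (Fin e) F)) : AddCommGroup (LocalDiffSpace m) :=
  inferInstanceAs (AddCommGroup ((Fin e →₀ ℕ) →₀ ResidueAt m))

noncomputable instance (m : Ideal (MvPolynomial (Fin e) F)) :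
    Module (ResidueAt m) (LocalDiffSpace m) :=
  inferInstanceAs (Module (ResidueAt m) ((Fin e →₀ ℕ) →₀ ResidueAt m))

/-- `D ↦ D · [g] = ∑ α, c_α [∂^α g] ∈ κ(m)`, for `D = ∑ α, c_α ∂^α`. -/
noncomputable def evalAt (m : Ideal (MvPolynomial (Fin e) F)) (g : MvPolynomial (Fin e) F) :
    LocalDiffSpace m →ₗ[ResidueAt m] ResidueAt m :=
  Finsupp.linearCombination (ResidueAt m) fun α : Fin e →₀ ℕ => residue m (partialMonomial α g)

/-- The local dual space `D_m[J]`: all `D ∈ κ(m)⟨∂_y⟩` with `D · [g] = 0` for every `g ∈ J`. -/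
noncomputable def localDual (m J : Ideal (MvPolynomial (Fin e) F)) :
    Submodule (ResidueAt m) (LocalDiffSpace m) :=
  ⨅ g ∈ J, LinearMap.ker (evalAt m g)

theorem mem_localDual {m J : Ideal (MvPolynomial (Fin e) F)} {D : LocalDiffSpace m} :
    D ∈ localDual m J ↔ ∀ g ∈ J, evalAt m g D = 0 := by
  simp [localDual, Submodule.mem_iInf]

/-- The saturation `J : m^∞`, the union of the increasing chain of the ideals `J : m^k`. -/
def saturation {R : Type*} [CommRing R] (J m : Ideal R) : Ideal R :=
  ⨆ k : ℕ, Submodule.colon J ((m ^ k : Ideal R) : Set R)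

theorem mem_saturation {R : Type*} [CommRing R] {J m : Ideal R} {g : R} :
    g ∈ saturation J m ↔ ∃ k : ℕ, ∀ h ∈ m ^ k, g * h ∈ J := by
  have hdir : Directed (· ≤ ·) fun k : ℕ => Submodule.colon J ((m ^ k : Ideal R) : Set R) :=
    Monotone.directed_le fun a b hab => Submodule.colon_mono le_rfl (Ideal.pow_le_pow_right hab)
  simp [saturation, Submodule.mem_iSup_of_directed _ hdir, Submodule.mem_colon]

/-- The excess dual space `E_m[J] = D_m[J] / D_m[J : m^∞]`. -/
abbrev ExcessDual (m J : Ideal (MvPolynomial (Fin e) F)) : Type _ :=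
  localDual m J ⧸ (localDual m (saturation J m)).submoduleOf (localDual m J)

/-- `A` is a set of elements of `D_m[J]` whose cosets span `E_m[J]` over `κ(m)`. -/
def SpansExcess (m J : Ideal (MvPolynomial (Fin e) F)) (A : Set (LocalDiffSpace m)) : Prop :=
  A ⊆ localDual m J ∧
    Submodule.span (ResidueAt m)
      (((localDual m (saturation J m)).submoduleOf (localDual m J)).mkQ ''
        {D : localDual m J | (D : LocalDiffSpace m) ∈ A}) =
      (⊤ : Submodule (ResidueAt m) (ExcessDual m J))

end Local

/-! ### Parameters `t ⊔ y` and the passage from `R` to `K(t) ⊗ R = K(t)[y]` -/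

section Parameters

variable {K : Type*} [Field K] {n : ℕ}

/-- A (global) regular system of parameters `t ⊔ y` of the polynomial ring `R = K[x₁, …, xₙ]`:
polynomials `t₁, …, t_d, y₁, …, yₑ` with `R = K[t, y]` a polynomial ring in the `t` and `y`. -/
structure ParameterSystem (K : Type*) [Field K] (n : ℕ) where
  d : ℕ
  e : ℕ
  t : Fin d → MvPolynomial (Fin n) K
  y : Fin e → MvPolynomial (Fin n) K
  bijective : Function.Bijective
    (aeval (Sum.elim y t) : MvPolynomial (Fin e ⊕ Fin d) K →ₐ[K] MvPolynomial (Fin n) K)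

namespace ParameterSystem

variable (P : ParameterSystem K n)

/-- The field of rational functions `K(t)`. -/
abbrev RatField : Type _ := FractionRing (MvPolynomial (Fin P.d) K)

/-- The isomorphism `R ≃ K[t][y]`. -/
noncomputable def equiv :
    MvPolynomial (Fin n) K ≃ₐ[K] MvPolynomial (Fin P.e) (MvPolynomial (Fin P.d) K) :=
  (AlgEquiv.ofBijective _ P.bijective).symm.trans (sumAlgEquiv K (Fin P.e) (Fin P.d))

/-- The canonical map `R = K[t][y] → K(t)[y] = K(t) ⊗ R`. -/
noncomputable def toRat : MvPolynomial (Fin n) K →+* MvPolynomial (Fin P.e) P.RatField :=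
  (MvPolynomial.map (algebraMap (MvPolynomial (Fin P.d) K) P.RatField)).comp
    (P.equiv : MvPolynomial (Fin n) K →+* MvPolynomial (Fin P.e) (MvPolynomial (Fin P.d) K))

/-- The extension of an ideal `J` of `R` to the ideal `K(t) ⊗ J` of `K(t)[y]`. -/
noncomputable def extend (J : Ideal (MvPolynomial (Fin n) K)) :
    Ideal (MvPolynomial (Fin P.e) P.RatField) :=
  J.map P.toRat

/-- `t` are free variables for `p`: a maximal family of elements whose cosets are algebraically
independent in `R / p`. -/
def IsFreeFor (p : Ideal (MvPolynomial (Fin n) K)) : Prop :=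
  IsTranscendenceBasis K fun i => Ideal.Quotient.mk p (P.t i)

theorem equiv_t (i : Fin P.d) : P.equiv (P.t i) = C (X i) := by
  rw [equiv, AlgEquiv.trans_apply, ← sumAlgEquiv_X_inr]
  congr 1
  rw [AlgEquiv.symm_apply_eq, AlgEquiv.ofBijective_apply, aeval_X, Sum.elim_inr]

theorem equiv_y (j : Fin P.e) : P.equiv (P.y j) = X j := by
  rw [equiv, AlgEquiv.trans_apply, ← sumAlgEquiv_X_inl K (Fin P.e) (Fin P.d)]
  congr 1
  rw [AlgEquiv.symm_apply_eq, AlgEquiv.ofBijective_apply, aeval_X, Sum.elim_inl]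

theorem toRat_t (i : Fin P.d) : P.toRat (P.t i) = C (algebraMap (MvPolynomial (Fin P.d) K) P.RatField (X i)) := by
  simp [toRat, P.equiv_t]

theorem toRat_y (j : Fin P.e) : P.toRat (P.y j) = X j := by
  simp [toRat, P.equiv_y]

/-- `K(t)[y]`, with the map `toRat`, is the localization of `R` at the nonzero polynomials in `t`,
that is, `K(t) ⊗ R`. -/
theorem isLocalization_toRat :
    letI := P.toRat.toAlgebra
    IsLocalization ((nonZeroDivisors (MvPolynomial (Fin P.d) K)).map
      (aeval P.t : MvPolynomial (Fin P.d) K →ₐ[K] MvPolynomial (Fin n) K))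
      (MvPolynomial (Fin P.e) P.RatField) := by
  let := MvPolynomial.algebraMvPolynomial (σ := Fin P.e) (R := MvPolynomial (Fin P.d) K)
    (S := P.RatField)
  have hloc : IsLocalization
      ((nonZeroDivisors (MvPolynomial (Fin P.d) K)).map (C (σ := Fin P.e)))
      (MvPolynomial (Fin P.e) P.RatField) := MvPolynomial.isLocalization _ _
  have hC : (P.equiv.toAlgHom.comp (aeval P.t)) =
      (IsScalarTower.toAlgHom K (MvPolynomial (Fin P.d) K)
        (MvPolynomial (Fin P.e) (MvPolynomial (Fin P.d) K))) := by
    ext i : 1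
    simp [P.equiv_t, MvPolynomial.algebraMap_eq]
  have hC' : ∀ q, P.equiv.symm (C q) = aeval P.t q := fun q => by
    rw [AlgEquiv.symm_apply_eq]
    exact (DFunLike.congr_fun hC q).symm
  have h := IsLocalization.isLocalization_of_base_ringEquiv
    ((nonZeroDivisors (MvPolynomial (Fin P.d) K)).map (C (σ := Fin P.e)))
    (MvPolynomial (Fin P.e) P.RatField) P.equiv.symm.toRingEquiv
  convert! h using 1
  ext z
  simp only [Submonoid.mem_map]
  constructor
  · rintro ⟨q, hq, rfl⟩
    exact ⟨C q, ⟨q, hq, rfl⟩, hC' q⟩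
  · rintro ⟨_, ⟨q, hq, rfl⟩, rfl⟩
    exact ⟨q, hq, (hC' q).symm⟩

end ParameterSystem

/-- The data attached to an associated prime `p` of `I`: a regular system of parameters `t ⊔ y`
such that `t` are free variables for `p`, and a finite set of differential operators
`A ⊆ D_{p(t)}[I(t)] ⊆ κ(p(t))⟨∂_y⟩` whose cosets span `E_{p(t)}[I(t)]`. -/
structure DualData (I p : Ideal (MvPolynomial (Fin n) K)) where
  params : ParameterSystem K n
  free : params.IsFreeFor p
  A : Set (LocalDiffSpace (params.extend p))
  finite : A.Finite
  spans : SpansExcess (params.extend p) (params.extend I) A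

/-- `D · [f] ∈ κ(p(t))` for an operator `D ∈ κ(p(t))⟨∂_y⟩` and a polynomial `f ∈ R`. -/
noncomputable def DualData.apply {I p : Ideal (MvPolynomial (Fin n) K)} (S : DualData I p)
    (D : LocalDiffSpace (S.params.extend p)) (f : MvPolynomial (Fin n) K) :
    ResidueAt (S.params.extend p) :=
  evalAt (S.params.extend p) (S.params.toRat f) D

end Parameters

end LocalDual

/-! Suppose f ∉ I and let p be a minimal prime of I : f. Then p is associated to R/I, and s p^k f ⊆
I for some s ∉ p and some k (`exists_associatedPrime_of_notMem`). Put m = p(t), J = I(t), F = K(t).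
Locally at m, f lies in J : m^∞, so D_m[J : m^∞] kills f; as the operators in A generate D_m[J]
modulo that subspace, all of D_m[J] kills f (`SpansExcess.evalAt_eq_zero`).

Duality now puts f in J locally at m. In characteristic 0 the residue field κ of m is étale over F,
so Taylor expansion at the κ-point y mod m identifies F[y]/m^k with κ[z]/(z)^k
(`exists_truncTaylor_inverse`). By Taylor's formula the κ-linear functionals on the latter are
operators in κ⟨∂_y⟩, hence f ∈ J + m^k for every k, and Krull's intersection theorem gives g ∉ m
with g f ∈ J. Clearing denominators in t yields r ∉ p with r f ∈ I, contradicting I : f ⊆ p. -/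

namespace LocalDual

open MvPolynomial

/-! ### Taylor expansion at a point with values in an étale extension -/

section Taylor

variable {F : Type*} [Field F] {e : ℕ} {κ : Type*} [CommRing κ] [Algebra F κ]

/-- The Taylor expansion `g ↦ g(a + z)` at the `κ`-valued point `a = π(X)`. -/
noncomputable def taylor (π : MvPolynomial (Fin e) F →ₐ[F] κ) :
    MvPolynomial (Fin e) F →ₐ[F] MvPolynomial (Fin e) κ :=
  aeval fun i => C (π (X i)) + X i

variable (π : MvPolynomial (Fin e) F →ₐ[F] κ)

theorem taylor_X (i : Fin e) : taylor π (X i) = C (π (X i)) + X i := by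
  simp [taylor]

theorem constantCoeff_taylor (g : MvPolynomial (Fin e) F) :
    constantCoeff (taylor π g) = π g := by
  induction g using MvPolynomial.induction_on with
  | C a =>
    rw [← algebraMap_eq, AlgHom.commutes, AlgHom.commutes, IsScalarTower.algebraMap_apply F κ,
      algebraMap_eq, constantCoeff_C]
  | add p q hp hq => simp only [map_add, hp, hq]
  | mul_X p i hp => simp only [map_mul, hp, taylor_X, map_add, constantCoeff_C, constantCoeff_X,
      add_zero]

theorem pderiv_taylor (i : Fin e) (g : MvPolynomial (Fin e) F) :
    pderiv i (taylor π g) = taylor π (pderiv i g) := by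
  induction g using MvPolynomial.induction_on with
  | C a =>
    rw [← algebraMap_eq, AlgHom.commutes, IsScalarTower.algebraMap_apply F κ, algebraMap_eq,
      algebraMap_eq, pderiv_C, pderiv_C, map_zero]
  | add p q hp hq => simp only [map_add, hp, hq]
  | mul_X p j hp =>
    have h : pderiv i (taylor π (X j)) = taylor π (pderiv i (X j)) := by
      rw [taylor_X, map_add, pderiv_C, zero_add, pderiv_X, pderiv_X]
      by_cases hij : j = i
      · subst hij; simp
      · simp [hij]
    rw [map_mul, pderiv_mul, pderiv_mul, hp, h, map_add, map_mul, map_mul]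

theorem coeff_taylor_pderiv_pow (i : Fin e) (k : ℕ) (g : MvPolynomial (Fin e) F)
    (s : Fin e →₀ ℕ) :
    coeff s (taylor π ((((pderiv i : Derivation F (MvPolynomial (Fin e) F)
        (MvPolynomial (Fin e) F)) :
        MvPolynomial (Fin e) F →ₗ[F] MvPolynomial (Fin e) F) ^ k) g)) =
      ((s i + 1).ascFactorial k : κ) * coeff (s + Finsupp.single i k) (taylor π g) := by
  induction k generalizing s with
  | zero => simp
  | succ k ih =>
    rw [pow_succ', Module.End.mul_apply, Derivation.coeFn_coe, ← pderiv_taylor, coeff_pderiv, ih,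
      add_assoc, ← Finsupp.single_add, add_comm 1 k]
    have h1 : (s + Finsupp.single i 1 : Fin e →₀ ℕ) i + 1 = s i + 1 + 1 := by simp
    have h2 : (s i + 1).ascFactorial (k + 1) = (s i + 1) * (s i + 1 + 1).ascFactorial k := by
      rw [Nat.ascFactorial_succ, Nat.succ_ascFactorial]
    rw [h1, h2]
    push_cast
    ring

/-- The factorial `α! = α₁! ⋯ αₑ!` of a multi-index. -/
def multiFactorial (α : Fin e →₀ ℕ) : ℕ := ∏ i, (α i).factorial

theorem multiFactorial_ne_zero (α : Fin e →₀ ℕ) : multiFactorial α ≠ 0 :=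
  Finset.prod_ne_zero_iff.mpr fun _ _ => Nat.factorial_ne_zero _

/-- The operators are peeled off one variable at a time. As the variables are distinct and s
vanishes on them, each ascending factorial starts at 1 and is a plain factorial. -/
theorem coeff_taylor_list_prod (α : Fin e →₀ ℕ) (l : List (Fin e)) (hl : l.Nodup)
    (g : MvPolynomial (Fin e) F) (s : Fin e →₀ ℕ) (hs : ∀ i ∈ l, s i = 0) :
    coeff s (taylor π ((l.map fun i => ((pderiv i : Derivation F (MvPolynomial (Fin e) F)
        (MvPolynomial (Fin e) F)) :
        MvPolynomial (Fin e) F →ₗ[F] MvPolynomial (Fin e) F) ^ α i).prod g)) =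
      ((l.map fun i => (α i).factorial).prod : ℕ) *
        coeff (s + (l.map fun i => Finsupp.single i (α i)).sum) (taylor π g) := by
  induction l generalizing s with
  | nil => simp
  | cons i l ih =>
    rw [List.nodup_cons] at hl
    rw [List.map_cons, List.prod_cons, Module.End.mul_apply, coeff_taylor_pderiv_pow,
      ih hl.2, hs i (by simp), zero_add, Nat.one_ascFactorial, List.map_cons, List.prod_cons,
      List.map_cons, List.sum_cons, add_assoc, Nat.cast_mul, mul_assoc]
    intro j hj
    have : j ≠ i := fun h => hl.1 (h ▸ hj)
    simp [hs j (by simp [hj]), this.symm]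

/-- Taylor's formula. -/
theorem map_partialMonomial (α : Fin e →₀ ℕ) (g : MvPolynomial (Fin e) F) :
    π (partialMonomial α g) = multiFactorial α * coeff α (taylor π g) := by
  rw [← constantCoeff_taylor, constantCoeff_eq, partialMonomial, List.ofFn_eq_map,
    coeff_taylor_list_prod π α _ (List.nodup_finRange e) g 0 (by simp), ← List.ofFn_eq_map,
    ← List.ofFn_eq_map, List.prod_ofFn, List.sum_ofFn, zero_add, Finsupp.univ_sum_single]
  rfl

theorem map_taylor_le : (RingHom.ker π).map (taylor π) ≤ idealOfVars (Fin e) κ := by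
  rw [Ideal.map_le_iff_le_comap]
  intro g hg
  rw [Ideal.mem_comap, ← pow_one (idealOfVars (Fin e) κ), mem_pow_idealOfVars_iff']
  intro x hx
  obtain rfl : x = 0 := by
    rw [← Finsupp.degree_eq_zero_iff]; omega
  rw [← constantCoeff_eq, constantCoeff_taylor, RingHom.mem_ker.mp hg]

theorem taylor_mem_pow {k : ℕ} {g : MvPolynomial (Fin e) F} (hg : g ∈ RingHom.ker π ^ k) :
    taylor π g ∈ idealOfVars (Fin e) κ ^ k := by
  refine Ideal.pow_right_mono (map_taylor_le π) k ?_
  rw [← Ideal.map_pow]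
  exact Ideal.mem_map_of_mem _ hg

/-- The Taylor expansion truncated at order `k`. -/
noncomputable def truncTaylor (k : ℕ) :
    MvPolynomial (Fin e) F →ₐ[F] MvPolynomial (Fin e) κ ⧸ idealOfVars (Fin e) κ ^ k :=
  (Ideal.Quotient.mkₐ F _).comp (taylor π)

theorem truncTaylor_apply (k : ℕ) (g : MvPolynomial (Fin e) F) :
    truncTaylor π k g = Ideal.Quotient.mk _ (taylor π g) := rfl

/-- If `κ` is formally étale over `F`, then it lifts to a coefficient ring of
`F[y] / (ker π) ^ k`. -/
theorem exists_coefficient_lift [Algebra.FormallyEtale F κ] (hπ : Function.Surjective π) {k : ℕ}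
    (hk : k ≠ 0) :
    ∃ σ : κ →ₐ[F] MvPolynomial (Fin e) F ⧸ RingHom.ker π ^ k,
      ∀ g c, σ c = Ideal.Quotient.mk _ g → π g = c := by
  have hle : RingHom.ker π ^ k ≤ RingHom.ker π := Ideal.pow_le_self hk
  let q : MvPolynomial (Fin e) F ⧸ RingHom.ker π ^ k →ₐ[F] κ :=
    Ideal.Quotient.liftₐ _ π fun a ha => hle ha
  have hq : Function.Surjective q := fun c => by
    obtain ⟨g, rfl⟩ := hπ c
    exact ⟨Ideal.Quotient.mk _ g, rfl⟩
  -- The kernel is the image of ker π, whose k-th power is zero in the quotient, so formal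
  -- smoothness lifts the identity of κ along q.
  have hnil : IsNilpotent (RingHom.ker q) := by
    refine ⟨k, ?_⟩
    have : RingHom.ker q ≤ (RingHom.ker π).map (Ideal.Quotient.mk _) := by
      intro x hx
      obtain ⟨g, rfl⟩ := Ideal.Quotient.mk_surjective x
      exact Ideal.mem_map_of_mem _ hx
    refine le_bot_iff.mp ((Ideal.pow_right_mono this k).trans ?_)
    rw [← Ideal.map_pow, Ideal.map_quotient_self]
  refine ⟨Algebra.FormallySmooth.liftOfSurjective (AlgHom.id F κ) q hq hnil, fun g c h => ?_⟩
  have := Algebra.FormallySmooth.liftOfSurjective_apply (AlgHom.id F κ) q hq hnil c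
  rw [h] at this
  exact this

/-- With σ the lift of κ and a the point π(X), the inverse sends c to σ c and z_i to X_i - σ(a_i),
undoing X_i ↦ a_i + z_i. It is a two-sided inverse modulo k-th powers. -/
theorem exists_truncTaylor_inverse [Algebra.FormallyEtale F κ] (hπ : Function.Surjective π)
    {k : ℕ} (hk : k ≠ 0) :
    ∃ ψ : MvPolynomial (Fin e) κ →ₐ[F] MvPolynomial (Fin e) F ⧸ RingHom.ker π ^ k,
      (∀ p ∈ idealOfVars (Fin e) κ ^ k, ψ p = 0) ∧
      (∀ g, ψ (taylor π g) = Ideal.Quotient.mk _ g) ∧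
      ∀ p g, ψ p = Ideal.Quotient.mk _ g → truncTaylor π k g = Ideal.Quotient.mk _ p := by
  obtain ⟨σ, hσ⟩ := exists_coefficient_lift π hπ hk
  let ψ : MvPolynomial (Fin e) κ →ₐ[F] MvPolynomial (Fin e) F ⧸ RingHom.ker π ^ k :=
    { eval₂Hom σ.toRingHom (fun i => Ideal.Quotient.mk _ (X i) - σ (π (X i))) with
      commutes' := fun r => by
        change eval₂Hom σ.toRingHom _ (algebraMap F (MvPolynomial (Fin e) κ) r) = _
        rw [IsScalarTower.algebraMap_apply F κ, algebraMap_eq, eval₂Hom_C]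
        exact σ.commutes r }
  have hψC : ∀ c, ψ (C c) = σ c := fun c => eval₂Hom_C _ _ c
  have hψX : ∀ i, ψ (X i) = Ideal.Quotient.mk _ (X i) - σ (π (X i)) := fun i => eval₂Hom_X' _ _ i
  have hψT : ∀ g, ψ (taylor π g) = Ideal.Quotient.mk _ g := by
    have : ψ.comp (taylor π) = Ideal.Quotient.mkₐ F _ := by
      ext i : 1
      rw [AlgHom.comp_apply, taylor_X, map_add, hψC, hψX, add_sub_cancel]
      rfl
    exact fun g => DFunLike.congr_fun this g
  have hker : ∀ p ∈ idealOfVars (Fin e) κ ^ k, ψ p = 0 := by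
    have h1 : (idealOfVars (Fin e) κ).map ψ ≤ (RingHom.ker π).map (Ideal.Quotient.mk _) := by
      rw [idealOfVars, Ideal.map_span, Ideal.span_le]
      rintro _ ⟨_, ⟨i, rfl⟩, rfl⟩
      obtain ⟨g, hg⟩ := Ideal.Quotient.mk_surjective (σ (π (X i)))
      rw [hψX, ← hg, ← map_sub]
      refine Ideal.mem_map_of_mem _ ?_
      rw [RingHom.mem_ker, map_sub, hσ g _ hg.symm, sub_self]
    intro p hp
    have h2 := Ideal.pow_right_mono h1 k
    rw [← Ideal.map_pow, ← Ideal.map_pow, Ideal.map_quotient_self] at h2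
    exact h2 (Ideal.mem_map_of_mem _ hp)
  refine ⟨ψ, hker, hψT, fun p g hpg => ?_⟩
  let τ : MvPolynomial (Fin e) F ⧸ RingHom.ker π ^ k →ₐ[F]
      MvPolynomial (Fin e) κ ⧸ idealOfVars (Fin e) κ ^ k :=
    Ideal.Quotient.liftₐ _ (truncTaylor π k) fun a ha =>
      Ideal.Quotient.eq_zero_iff_mem.mpr (taylor_mem_pow π ha)
  have hτ : ∀ g, τ (Ideal.Quotient.mk _ g) = truncTaylor π k g := fun g => rfl
  have hnil : IsNilpotent ((idealOfVars (Fin e) κ).map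
      (Ideal.Quotient.mk (idealOfVars (Fin e) κ ^ k))) :=
    ⟨k, by rw [← Ideal.map_pow, Ideal.map_quotient_self]; rfl⟩
  -- Both maps embed κ in κ[z]/(z)^k and agree modulo the nilpotent ideal (z), so formal
  -- unramifiedness makes them equal.
  have hC : τ.comp σ = (Ideal.Quotient.mkₐ F (idealOfVars (Fin e) κ ^ k)).comp
      (IsScalarTower.toAlgHom F κ (MvPolynomial (Fin e) κ)) := by
    refine Algebra.FormallyUnramified.ext _ hnil fun c => ?_
    obtain ⟨g, hg⟩ := Ideal.Quotient.mk_surjective (σ c)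
    rw [Ideal.Quotient.eq]
    change τ (σ c) - Ideal.Quotient.mk _ (C c) ∈ _
    rw [← hg, hτ, truncTaylor_apply, ← map_sub]
    refine Ideal.mem_map_of_mem _ ?_
    rw [← pow_one (idealOfVars (Fin e) κ), mem_pow_idealOfVars_iff']
    intro x hx
    obtain rfl : x = 0 := by
      rw [← Finsupp.degree_eq_zero_iff]; omega
    rw [← constantCoeff_eq, map_sub, constantCoeff_taylor, constantCoeff_C, hσ g c hg.symm,
      sub_self]
  have hC' : ∀ c, τ (σ c) = Ideal.Quotient.mk _ (C c) := fun c => DFunLike.congr_fun hC c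
  have hall : ∀ p, τ (ψ p) = Ideal.Quotient.mk _ p := by
    intro p
    induction p using MvPolynomial.induction_on with
    | C c => rw [hψC, hC']
    | add p q hp hq => rw [map_add, map_add, hp, hq, map_add]
    | mul_X p i hp =>
      rw [map_mul, map_mul, hp, hψX, map_sub, hC', hτ, truncTaylor_apply, taylor_X, map_add,
        add_sub_cancel_left, map_mul]
  rw [← hτ, ← hpg, hall]

theorem truncTaylor_surjective [Algebra.FormallyEtale F κ] (hπ : Function.Surjective π) {k : ℕ}
    (hk : k ≠ 0) :
    Function.Surjective (truncTaylor π k) := by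
  obtain ⟨ψ, -, -, h⟩ := exists_truncTaylor_inverse π hπ hk
  intro x
  obtain ⟨p, rfl⟩ := Ideal.Quotient.mk_surjective x
  obtain ⟨g, hg⟩ := Ideal.Quotient.mk_surjective (ψ p)
  exact ⟨g, h p g hg.symm⟩

theorem mem_pow_of_truncTaylor_eq_zero [Algebra.FormallyEtale F κ] (hπ : Function.Surjective π)
    {k : ℕ} (hk : k ≠ 0) {g : MvPolynomial (Fin e) F} (hg : truncTaylor π k g = 0) :
    g ∈ RingHom.ker π ^ k := by
  obtain ⟨ψ, h1, h2, -⟩ := exists_truncTaylor_inverse π hπ hk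
  rw [← Ideal.Quotient.eq_zero_iff_mem, ← h2]
  exact h1 _ (Ideal.Quotient.eq_zero_iff_mem.mp hg)

end Taylor

theorem exists_functional {F : Type*} [Field F] {e : ℕ} {κ : Type*} [Field κ] [Algebra F κ]
    [Algebra.FormallyEtale F κ] (π : MvPolynomial (Fin e) F →ₐ[F] κ) (hπ : Function.Surjective π)
    (J : Ideal (MvPolynomial (Fin e) F)) (k : ℕ) {f : MvPolynomial (Fin e) F}
    (hf : f ∉ J ⊔ RingHom.ker π ^ k) :
    ∃ L : MvPolynomial (Fin e) κ →ₗ[κ] κ, (∀ p ∈ idealOfVars (Fin e) κ ^ k, L p = 0) ∧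
      (∀ g ∈ J, L (taylor π g) = 0) ∧ L (taylor π f) ≠ 0 := by
  have hk : k ≠ 0 := by
    rintro rfl
    simp [Ideal.one_eq_top] at hf
  -- J itself carries no κ-structure, but by surjectivity its image is an ideal of a κ-algebra,
  -- hence a κ-subspace that a κ-linear functional can separate from f.
  have hf' : truncTaylor π k f ∉ (J.map (truncTaylor π k)).restrictScalars κ := by
    intro h
    obtain ⟨j, hj, hjf⟩ := (Ideal.mem_map_iff_of_surjective (truncTaylor π k)
      (truncTaylor_surjective π hπ hk)).mp h
    refine hf (Submodule.mem_sup.mpr ⟨j, hj, f - j, ?_, add_sub_cancel _ _⟩)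
    exact mem_pow_of_truncTaylor_eq_zero π hπ hk (by rw [map_sub, hjf, sub_self])
  obtain ⟨l, hlf, hl⟩ := Submodule.exists_le_ker_of_notMem hf'
  refine ⟨l.comp (Ideal.Quotient.mkₐ κ _).toLinearMap, fun p hp => ?_, fun g hg => ?_, hlf⟩
  · have : (Ideal.Quotient.mkₐ κ (idealOfVars (Fin e) κ ^ k)) p = 0 :=
      Ideal.Quotient.eq_zero_iff_mem.mpr hp
    rw [LinearMap.comp_apply, AlgHom.toLinearMap_apply, this, map_zero]
  · exact hl (show truncTaylor π k g ∈ _ from Ideal.mem_map_of_mem _ hg)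

end LocalDual

namespace LocalDual

open MvPolynomial

/-! ### Duality at a maximal ideal of F[y] -/

section Local

variable {F : Type*} [Field F] {e : ℕ}

/-- The quotient map onto the residue ring as an algebra map. -/
noncomputable abbrev residueHom (m : Ideal (MvPolynomial (Fin e) F)) :
    MvPolynomial (Fin e) F →ₐ[F] MvPolynomial (Fin e) F ⧸ m :=
  Ideal.Quotient.mkₐ F m

theorem ker_residueHom (m : Ideal (MvPolynomial (Fin e) F)) : RingHom.ker (residueHom m) = m :=
  Ideal.Quotient.mkₐ_ker F m

theorem evalAt_eq_sum (m : Ideal (MvPolynomial (Fin e) F)) (D : LocalDiffSpace m)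
    (g : MvPolynomial (Fin e) F) :
    evalAt m g D = Finsupp.sum (M := MvPolynomial (Fin e) F ⧸ m) D fun α c =>
      c * (multiFactorial α * coeff α (taylor (residueHom m) g)) := by
  refine (Finsupp.linearCombination_apply _ _).trans (Finset.sum_congr rfl fun α _ => ?_)
  exact congrArg _ (map_partialMonomial (residueHom m) α g)

/-- An operator has finite order, while Taylor expansions of elements of m^k have no terms of degree
below k. -/
theorem exists_evalAt_eq_zero_of_mem_pow (m : Ideal (MvPolynomial (Fin e) F))
    (D : LocalDiffSpace m) : ∃ k : ℕ, ∀ g ∈ m ^ k, evalAt m g D = 0 := by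
  let D' : (Fin e →₀ ℕ) →₀ (MvPolynomial (Fin e) F ⧸ m) := D
  refine ⟨D'.support.sup Finsupp.degree + 1, fun g hg => ?_⟩
  rw [evalAt_eq_sum]
  refine Finset.sum_eq_zero fun α hα => ?_
  have hg' : g ∈ RingHom.ker (residueHom m) ^ (D'.support.sup Finsupp.degree + 1) :=
    (ker_residueHom m).symm ▸ hg
  have h := (mem_pow_idealOfVars_iff' _ _).mp (taylor_mem_pow (residueHom m) hg') α
    (Nat.lt_succ_of_le (Finset.le_sup (f := Finsupp.degree) hα))
  change _ * (_ * coeff α _) = (0 : MvPolynomial (Fin e) F ⧸ m)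
  rw [h, mul_zero, mul_zero]

theorem evalAt_add (m : Ideal (MvPolynomial (Fin e) F)) (D : LocalDiffSpace m)
    (g h : MvPolynomial (Fin e) F) : evalAt m (g + h) D = evalAt m g D + evalAt m h D := by
  simp only [evalAt_eq_sum, map_add, coeff_add, mul_add]
  exact Finsupp.sum_add

/-- Local dual spaces depend only on the localization at `m`. -/
theorem evalAt_eq_zero_of_mul_mem {m J : Ideal (MvPolynomial (Fin e) F)} (hm : m.IsMaximal)
    {D : LocalDiffSpace m} (hD : D ∈ localDual m J) {s f : MvPolynomial (Fin e) F} (hs : s ∉ m)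
    (hsf : s * f ∈ J) : evalAt m f D = 0 := by
  obtain ⟨k, hk⟩ := exists_evalAt_eq_zero_of_mem_pow m D
  -- Since s is a unit modulo m^k, f is a multiple of s f up to an element of m^k, which D kills.
  have htop : Ideal.span {s} ⊔ m ^ k = ⊤ := by
    have h1 : Ideal.span {s} ⊔ m = ⊤ :=
      (sup_comm _ _).trans (hm.1.2 _ (left_lt_sup.mpr
        fun h => hs (h (Ideal.mem_span_singleton_self s))))
    exact Ideal.sup_pow_eq_top h1
  obtain ⟨u, hu, v, hv, huv⟩ := Submodule.mem_sup.mp ((Ideal.eq_top_iff_one _).mp htop)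
  obtain ⟨w, rfl⟩ := Ideal.mem_span_singleton'.mp hu
  have hf : f = w * (s * f) + v * f := by
    rw [← mul_assoc, ← add_mul, huv, one_mul]
  rw [hf, evalAt_add, mem_localDual.mp hD _ (J.mul_mem_left w hsf),
    hk _ (Ideal.mul_mem_right f _ hv), add_zero]

/-- The residue field is finite over F by the Nullstellensatz, and separable in characteristic 0. -/
theorem formallyEtale_residue [CharZero F] (m : Ideal (MvPolynomial (Fin e) F)) [hm : m.IsMaximal] :
    Algebra.FormallyEtale F (MvPolynomial (Fin e) F ⧸ m) := by
  let := Ideal.Quotient.field m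
  have : Module.Finite F (MvPolynomial (Fin e) F ⧸ m) :=
    finite_of_finite_type_of_isJacobsonRing F _
  exact Algebra.FormallyEtale.of_isSeparable F _

/-- A linear functional on `κ[z]` vanishing on `(z) ^ k` is a finite combination of the functionals
`p ↦ α! coeff α p`. -/
theorem exists_finsupp_eq_functional [CharZero F] {κ : Type*} [CommRing κ] [Algebra F κ] (k : ℕ)
    (L : MvPolynomial (Fin e) κ →ₗ[κ] κ) (hL : ∀ p ∈ idealOfVars (Fin e) κ ^ k, L p = 0) :
    ∃ D : (Fin e →₀ ℕ) →₀ κ,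
      ∀ p, (D.sum fun α c => c * (multiFactorial α * coeff α p)) = L p := by
  have hdeg : ∀ α : Fin e →₀ ℕ, k ≤ α.degree → L (monomial α 1) = 0 := by
    intro α hα
    refine hL _ ((mem_pow_idealOfVars_iff' _ _).mpr fun x hx => ?_)
    rw [coeff_monomial, if_neg]
    rintro rfl
    omega
  -- The coefficient of ∂^α is L(z^α)/α!; it vanishes once α has degree at least k.
  refine ⟨Finsupp.ofSupportFinite
    (fun α => algebraMap F κ (multiFactorial α : F)⁻¹ * L (monomial α 1))
    ((Finsupp.finite_of_degree_lt k).subset fun α hα => ?_), fun p => ?_⟩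
  · by_contra h
    refine hα ?_
    change algebraMap F κ (multiFactorial α : F)⁻¹ * L (monomial α 1) = 0
    rw [hdeg α (not_lt.mp h), mul_zero]
  induction p using MvPolynomial.induction_on' with
  | monomial s c =>
    have h1 : (monomial s c : MvPolynomial (Fin e) κ) = c • monomial s 1 := by
      rw [smul_monomial, smul_eq_mul, mul_one]
    have hc : algebraMap F κ (multiFactorial s : F)⁻¹ * multiFactorial s = 1 := by
      rw [← map_natCast (algebraMap F κ), ← map_mul,
        inv_mul_cancel₀ (Nat.cast_ne_zero.mpr (multiFactorial_ne_zero s)), map_one]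
    rw [Finsupp.sum, Finset.sum_eq_single s, coeff_monomial, if_pos rfl, h1, map_smul, smul_eq_mul,
      Finsupp.ofSupportFinite_coe]
    · linear_combination (L (monomial s 1) * c) * hc
    · intro α _ hα
      rw [coeff_monomial, if_neg hα.symm, mul_zero, mul_zero]
    · intro hs
      rw [Finsupp.notMem_support_iff.mp hs, zero_mul]
  | add p q hp hq =>
    simp only [coeff_add, mul_add, map_add]
    rw [← hp, ← hq]
    exact Finsupp.sum_add

/-- An element killed by all of `D_m[J]` lies in the `m`-adic closure of `J`. -/
theorem mem_sup_pow_of_evalAt_eq_zero [CharZero F] {m J : Ideal (MvPolynomial (Fin e) F)}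
    (hm : m.IsMaximal) {f : MvPolynomial (Fin e) F}
    (hf : ∀ D ∈ localDual m J, evalAt m f D = 0) (k : ℕ) : f ∈ J ⊔ m ^ k := by
  let := Ideal.Quotient.field m
  have := formallyEtale_residue m
  by_contra h
  rw [← ker_residueHom m] at h
  obtain ⟨L, hL, hJ, hLf⟩ := exists_functional (residueHom m) (Ideal.Quotient.mkₐ_surjective F m)
    J k h
  obtain ⟨D, hD'⟩ := exists_finsupp_eq_functional (F := F) k L hL
  have hD : ∀ g, evalAt m g D = L (taylor (residueHom m) g) := fun g =>
    (evalAt_eq_sum m D g).trans (hD' _)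
  exact hLf ((hD f).symm.trans (hf D (mem_localDual.mpr fun g hg => (hD g).trans (hJ g hg))))

/-- Krull's intersection theorem in F[y]/J: a class lying in every power of m is fixed by some r ∈
m, so 1 - r serves as s. -/
theorem exists_notMem_mul_mem [CharZero F] {m J : Ideal (MvPolynomial (Fin e) F)}
    (hm : m.IsMaximal) {f : MvPolynomial (Fin e) F}
    (hf : ∀ D ∈ localDual m J, evalAt m f D = 0) : ∃ s ∉ m, s * f ∈ J := by
  have h : Ideal.Quotient.mk J f ∈ (⨅ k : ℕ, m ^ k • ⊤ :
      Submodule (MvPolynomial (Fin e) F) (MvPolynomial (Fin e) F ⧸ J)) := by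
    rw [Submodule.mem_iInf]
    intro k
    obtain ⟨j, hj, v, hv, rfl⟩ := Submodule.mem_sup.mp (mem_sup_pow_of_evalAt_eq_zero hm hf k)
    rw [map_add, Ideal.Quotient.eq_zero_iff_mem.mpr hj, zero_add]
    have := Submodule.smul_mem_smul hv (Submodule.mem_top (x := Ideal.Quotient.mk J 1))
    rwa [← Ideal.Quotient.mk_eq_mk, ← Submodule.Quotient.mk_smul, smul_eq_mul, mul_one] at this
  obtain ⟨r, hr⟩ := (m.mem_iInf_smul_pow_eq_bot_iff _).mp h
  refine ⟨1 - r, fun h1 => hm.ne_top ((Ideal.eq_top_iff_one _).mpr ?_), ?_⟩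
  · simpa using add_mem h1 r.2
  · rw [← Ideal.Quotient.eq_zero_iff_mem, sub_mul, one_mul, map_sub, sub_eq_zero]
    exact hr.symm

/-- Operators representing generators of the excess dual space detect membership of elements
that lie locally in the saturation. -/
theorem SpansExcess.evalAt_eq_zero {m J : Ideal (MvPolynomial (Fin e) F)} (hm : m.IsMaximal)
    {A : Set (LocalDiffSpace m)} (hA : SpansExcess m J A) {s f : MvPolynomial (Fin e) F}
    (hs : s ∉ m) (hsf : s * f ∈ saturation J m) (hf : ∀ D ∈ A, evalAt m f D = 0) :
    ∀ D ∈ localDual m J, evalAt m f D = 0 := by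
  intro D hD
  obtain ⟨-, hspan⟩ := hA
  have hle : (localDual m (saturation J m)).submoduleOf (localDual m J) ≤
      (LinearMap.ker (evalAt m f)).comap (localDual m J).subtype := fun E hE =>
    evalAt_eq_zero_of_mul_mem hm hE hs hsf
  have hle' : Submodule.span (ResidueAt m) {D : localDual m J | (D : LocalDiffSpace m) ∈ A} ≤
      (LinearMap.ker (evalAt m f)).comap (localDual m J).subtype :=
    Submodule.span_le.mpr fun E hE => hf _ hE
  rw [← Submodule.map_span, Submodule.map_mkQ_eq_top] at hspan
  have : (⟨D, hD⟩ : localDual m J) ∈ (⊤ : Submodule (ResidueAt m) (localDual m J)) :=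
    Submodule.mem_top
  rw [← hspan] at this
  exact sup_le hle hle' this

end Local

end LocalDual

namespace LocalDual

open MvPolynomial

/-! ### Minimal primes of I : f -/

section Noetherian

variable {R : Type*} [CommRing R] [IsNoetherianRing R]

/-- In the localization at p the radical of L is the maximal ideal, so L contains a power of it.
Multiplying the denominators for finitely many generators of p^k gives a single s. -/
theorem exists_notMem_pow_mul_mem {L p : Ideal R} (hp : p ∈ L.minimalPrimes) :
    ∃ s ∉ p, ∃ k : ℕ, ∀ x ∈ p ^ k, s * x ∈ L := by
  classical
  have hprime : p.IsPrime := hp.isPrime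
  have hrad := IsLocalization.AtPrime.radical_map_of_mem_minimalPrimes
    (Localization.AtPrime p) p L hp
  obtain ⟨k, hk⟩ := Ideal.exists_pow_le_of_le_radical_of_fg hrad.ge
    (IsNoetherian.noetherian (p.map (algebraMap R (Localization.AtPrime p))))
  have hex : ∀ x ∈ p ^ k, ∃ t ∉ p, t * x ∈ L := by
    intro x hx
    have h := hk (Ideal.map_pow (algebraMap R (Localization.AtPrime p)) p k ▸
      Ideal.mem_map_of_mem _ hx)
    rw [IsLocalization.algebraMap_mem_map_algebraMap_iff p.primeCompl] at h
    obtain ⟨t, ht, htx⟩ := h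
    exact ⟨t, ht, htx⟩
  obtain ⟨G, hG⟩ := IsNoetherian.noetherian (p ^ k)
  choose! t ht htL using hex
  have hGmem : ∀ g ∈ G, g ∈ p ^ k := fun g hg => hG ▸ Submodule.subset_span hg
  refine ⟨∏ g ∈ G, t g, fun h => ?_, k, fun x hx => ?_⟩
  · obtain ⟨g, hg, hgp⟩ := hprime.prod_mem_iff.mp h
    exact ht g (hGmem g hg) hgp
  · rw [← hG] at hx
    induction hx using Submodule.span_induction with
    | mem g hg =>
      rw [← Finset.prod_erase_mul _ _ hg, mul_assoc]
      exact L.mul_mem_left _ (htL g (hGmem g hg))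
    | zero => rw [mul_zero]; exact L.zero_mem
    | add x y _ _ hx hy => rw [mul_add]; exact L.add_mem hx hy
    | smul a x _ hx => rw [smul_eq_mul, mul_left_comm]; exact L.mul_mem_left _ hx

/-- If `f ∉ I`, then some associated prime `p` of `I` is minimal over `I : f`. -/
theorem exists_associatedPrime_of_notMem {I : Ideal R} {f : R} (hf : f ∉ I) :
    ∃ p ∈ associatedPrimes R (R ⧸ I), (∀ r, r * f ∈ I → r ∈ p) ∧
      ∃ s ∉ p, ∃ k : ℕ, ∀ x ∈ p ^ k, s * x * f ∈ I := by
  let φ : R →ₗ[R] R ⧸ I := LinearMap.toSpanSingleton R (R ⧸ I) (Ideal.Quotient.mk I f)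
  let L : Ideal R := LinearMap.ker φ
  have hL : ∀ r, r ∈ L ↔ r * f ∈ I := fun r => (Ideal.Quotient.eq_zero_iff_mem (I := I) (a := r * f))
  have hne : L ≠ ⊤ := fun h => hf (by simpa using (hL 1).mp (h ▸ Submodule.mem_top))
  obtain ⟨p, hp⟩ := Ideal.nonempty_minimalPrimes hne
  have hass : p ∈ associatedPrimes R (R ⧸ L) := by
    refine Module.associatedPrimes.minimalPrimes_annihilator_subset_associatedPrimes R (R ⧸ L) ?_
    rwa [Ideal.annihilator_quotient]
  -- Multiplication by f embeds R/L in R/I, so associated primes of R/L are associated to R/I.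
  have hinj : Function.Injective (L.liftQ φ le_rfl) :=
    LinearMap.ker_eq_bot.mp (Submodule.ker_liftQ_eq_bot' _ _ rfl)
  obtain ⟨s, hs, k, hk⟩ := exists_notMem_pow_mul_mem hp
  exact ⟨p, associatedPrimes.subset_of_injective hinj hass, fun r hr => hp.le ((hL r).mpr hr),
    s, hs, k, fun x hx => (hL _).mp (hk x hx)⟩

end Noetherian

/-! ### Extension of a prime to K(t)[y] -/

section Algebraic

theorem isIntegral_of_surjective {E σ B : Type*} [CommRing E] [CommRing B] [Algebra E B]
    (π : MvPolynomial σ E →ₐ[E] B) (hπ : Function.Surjective π)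
    (h : ∀ j, IsIntegral E (π (X j))) : Algebra.IsIntegral E B := by
  refine ⟨fun b => ?_⟩
  obtain ⟨g, rfl⟩ := hπ b
  induction g using MvPolynomial.induction_on with
  | C a =>
    rw [← algebraMap_eq, AlgHom.commutes]
    exact isIntegral_algebraMap
  | add g g' hg hg' => rw [map_add]; exact hg.add hg'
  | mul_X g j hg => rw [map_mul]; exact hg.mul (h j)

/-- Under a ring map compatible with the evaluation at algebraically independent `x`, an element
algebraic over the subalgebra generated by `x` becomes integral over the field of rational functions
in `x`. -/
theorem isIntegral_map_of_algebraicIndependent {K ι A E B : Type*} [CommRing K] [CommRing A]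
    [Algebra K A] [Field E] [Algebra (MvPolynomial ι K) E] [FaithfulSMul (MvPolynomial ι K) E]
    [CommRing B] [Algebra E B] {x : ι → A} (hx : AlgebraicIndependent K x) (θ : A →+* B)
    (hθx : ∀ q : MvPolynomial ι K, θ (aeval x q) = algebraMap E B (algebraMap _ E q)) {a : A}
    (ha : IsAlgebraic (Algebra.adjoin K (Set.range x)) a) : IsIntegral E (θ a) := by
  let ε : Algebra.adjoin K (Set.range x) →+* E :=
    (algebraMap (MvPolynomial ι K) E).comp
      (hx.aevalEquiv.symm : _ ≃ₐ[K] _).toRingEquiv.toRingHom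
  have hε : Function.Injective ε :=
    (FaithfulSMul.algebraMap_injective _ E).comp hx.aevalEquiv.symm.injective
  refine (ha.ringHom_of_comp_eq ε θ hε ?_).isIntegral
  ext z
  obtain ⟨q, rfl⟩ := hx.aevalEquiv.surjective z
  change algebraMap E B (algebraMap _ E (hx.aevalEquiv.symm (hx.aevalEquiv q))) =
    θ (hx.aevalEquiv q)
  rw [AlgEquiv.symm_apply_apply, ← hθx, AlgebraicIndependent.aevalEquiv_apply_coe]

end Algebraic

namespace ParameterSystem

variable {K : Type*} [Field K] {n : ℕ} (P : ParameterSystem K n)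

/-- The nonzero polynomials in `t`, as a submonoid of `R`. -/
noncomputable def denominators : Submonoid (MvPolynomial (Fin n) K) :=
  (nonZeroDivisors (MvPolynomial (Fin P.d) K)).map
    (aeval P.t : MvPolynomial (Fin P.d) K →ₐ[K] MvPolynomial (Fin n) K)

variable {P} {p : Ideal (MvPolynomial (Fin n) K)}

/-- Algebraic independence of t modulo p says that no nonzero polynomial in t lies in p. -/
theorem IsFreeFor.disjoint (h : P.IsFreeFor p) :
    Disjoint (P.denominators : Set (MvPolynomial (Fin n) K)) p := by
  rw [Set.disjoint_left]
  rintro _ ⟨q, hq, rfl⟩ hqp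
  refine nonZeroDivisors.ne_zero hq (h.1 ?_)
  rw [map_zero]
  have : (aeval fun i => Ideal.Quotient.mk p (P.t i)) q =
      Ideal.Quotient.mkₐ K p (aeval P.t q) := (comp_aeval_apply _ (Ideal.Quotient.mkₐ K p) q).symm
  rw [this]
  exact Ideal.Quotient.eq_zero_iff_mem.mpr hqp

theorem IsFreeFor.isPrime_extend (h : P.IsFreeFor p) (hp : p.IsPrime) :
    (P.extend p).IsPrime := by
  let := P.toRat.toAlgebra
  have : IsLocalization P.denominators (MvPolynomial (Fin P.e) P.RatField) :=
    P.isLocalization_toRat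
  exact IsLocalization.isPrime_of_isPrime_disjoint P.denominators _ p hp h.disjoint

theorem IsFreeFor.comap_extend (h : P.IsFreeFor p) (hp : p.IsPrime) :
    (P.extend p).comap P.toRat = p := by
  let := P.toRat.toAlgebra
  have : IsLocalization P.denominators (MvPolynomial (Fin P.e) P.RatField) :=
    P.isLocalization_toRat
  exact IsLocalization.under_map_of_isPrime_disjoint P.denominators _ hp h.disjoint

theorem toRat_aeval_t (q : MvPolynomial (Fin P.d) K) :
    P.toRat (aeval P.t q) = C (algebraMap _ P.RatField q) := by
  have : (P.toRat.comp (aeval P.t : MvPolynomial (Fin P.d) K →ₐ[K] _).toRingHom) =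
      (C : P.RatField →+* MvPolynomial (Fin P.e) P.RatField).comp (algebraMap _ P.RatField) := by
    refine MvPolynomial.ringHom_ext (fun a => ?_) fun i => ?_
    · change P.toRat (aeval P.t (C a)) = C (algebraMap _ P.RatField (C a))
      rw [← algebraMap_eq, AlgHom.commutes]
      change MvPolynomial.map _ (P.equiv (algebraMap K _ a)) = _
      rw [AlgEquiv.commutes, IsScalarTower.algebraMap_apply K (MvPolynomial (Fin P.d) K),
        algebraMap_eq, map_C]
    · simp [toRat_t]
  exact DFunLike.congr_fun this q

/-- The quotient is a domain generated over K(t) by the classes of y, which are algebraic because t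
is a transcendence basis modulo p. A domain integral over a field is a field. -/
theorem IsFreeFor.isMaximal_extend (h : P.IsFreeFor p) (hp : p.IsPrime) :
    (P.extend p).IsMaximal := by
  have hprime := h.isPrime_extend hp
  let θ : MvPolynomial (Fin n) K ⧸ p →+* MvPolynomial (Fin P.e) P.RatField ⧸ P.extend p :=
    Ideal.quotientMap _ P.toRat Ideal.le_comap_map
  have hθt : ∀ q : MvPolynomial (Fin P.d) K,
      θ (aeval (fun i => Ideal.Quotient.mk p (P.t i)) q) =
        algebraMap P.RatField _ (algebraMap _ P.RatField q) := by
    intro q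
    have h1 : (aeval fun i => Ideal.Quotient.mk p (P.t i)) q =
        Ideal.Quotient.mkₐ K p (aeval P.t q) :=
      (comp_aeval_apply _ (Ideal.Quotient.mkₐ K p) q).symm
    rw [h1]
    change Ideal.Quotient.mk _ (P.toRat (aeval P.t q)) = _
    rw [toRat_aeval_t]
    rfl
  have halg := h.isAlgebraic
  have hint : Algebra.IsIntegral P.RatField (MvPolynomial (Fin P.e) P.RatField ⧸ P.extend p) := by
    refine isIntegral_of_surjective (E := P.RatField)
      (B := MvPolynomial (Fin P.e) P.RatField ⧸ P.extend p)
      (Ideal.Quotient.mkₐ P.RatField (P.extend p)) (Ideal.Quotient.mkₐ_surjective _ _) fun j => ?_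
    have h2 : θ (Ideal.Quotient.mk p (P.y j)) = Ideal.Quotient.mkₐ P.RatField (P.extend p) (X j) :=
      congrArg (Ideal.Quotient.mk (P.extend p)) (P.toRat_y j)
    rw [← h2]
    exact isIntegral_map_of_algebraicIndependent (E := P.RatField)
      (B := MvPolynomial (Fin P.e) P.RatField ⧸ P.extend p) h.1 θ hθt
      (halg.isAlgebraic (Ideal.Quotient.mk p (P.y j)))
  have := isField_of_isIntegral_of_isField' (R := P.RatField)
    (S := MvPolynomial (Fin P.e) P.RatField ⧸ P.extend p) (Field.toIsField _)
  exact Ideal.Quotient.maximal_of_isField _ this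

end ParameterSystem

/-! ### Local membership and descent to R -/

section Main

variable {K : Type*} [Field K] {n : ℕ}

theorem DualData.apply_eq_zero_of_mem {I p : Ideal (MvPolynomial (Fin n) K)} (S : DualData I p)
    {f : MvPolynomial (Fin n) K} (hf : f ∈ I) {D : LocalDiffSpace (S.params.extend p)}
    (hD : D ∈ S.A) : S.apply D f = 0 :=
  mem_localDual.mp (S.spans.1 hD) _ (Ideal.mem_map_of_mem _ hf)

theorem DualData.exists_notMem_mul_mem [CharZero K] {I p : Ideal (MvPolynomial (Fin n) K)} (S : DualData I p)
    (hp : p.IsPrime) {s f : MvPolynomial (Fin n) K} (hs : s ∉ p) {k : ℕ}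
    (hk : ∀ x ∈ p ^ k, s * x * f ∈ I) (hf : ∀ D ∈ S.A, S.apply D f = 0) :
    ∃ r ∉ p, r * f ∈ I := by
  let P := S.params
  have hm : (P.extend p).IsMaximal := S.free.isMaximal_extend hp
  have hcomap : ∀ r, P.toRat r ∈ P.extend p ↔ r ∈ p := fun r => by
    conv_rhs => rw [← S.free.comap_extend hp]
    rfl
  have hsat : P.toRat s * P.toRat f ∈ saturation (P.extend I) (P.extend p) := by
    refine mem_saturation.mpr ⟨k, fun x hx => ?_⟩
    rw [ParameterSystem.extend, ← Ideal.map_pow] at hx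
    have hle : (p ^ k).map P.toRat ≤
        (P.extend I).colon ({P.toRat s * P.toRat f} : Set _) := by
      rw [Ideal.map_le_iff_le_comap]
      intro y hy
      rw [Ideal.mem_comap, Submodule.mem_colon_singleton, smul_eq_mul, ← map_mul, ← map_mul]
      refine Ideal.mem_map_of_mem _ ?_
      rw [show y * (s * f) = s * y * f by ring]
      exact hk y hy
    have := Submodule.mem_colon_singleton.mp (hle hx)
    rwa [smul_eq_mul, mul_comm] at this
  obtain ⟨g, hg, hgf⟩ := LocalDual.exists_notMem_mul_mem hm
    (S.spans.evalAt_eq_zero hm (fun h => hs ((hcomap s).mp h)) hsat hf)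
  let := P.toRat.toAlgebra
  have : IsLocalization P.denominators (MvPolynomial (Fin P.e) P.RatField) :=
    P.isLocalization_toRat
  obtain ⟨⟨a, b⟩, hab⟩ := IsLocalization.surj P.denominators g
  change g * P.toRat b = P.toRat a at hab
  have hamem : algebraMap (MvPolynomial (Fin n) K) (MvPolynomial (Fin P.e) P.RatField) (a * f) ∈
      I.map (algebraMap (MvPolynomial (Fin n) K) (MvPolynomial (Fin P.e) P.RatField)) := by
    change P.toRat (a * f) ∈ P.extend I
    rw [map_mul, ← hab, mul_right_comm]
    exact Ideal.mul_mem_right _ _ hgf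
  rw [IsLocalization.algebraMap_mem_map_algebraMap_iff P.denominators] at hamem
  obtain ⟨c, hc, hcaf⟩ := hamem
  -- Here g = a/b, and the denominator c clears those in a f ∈ I(t). Neither b nor c lies in p, so c
  -- a ∈ p would force g ∈ p(t).
  refine ⟨c * a, fun h => ?_, by rwa [mul_assoc]⟩
  rcases hp.mem_or_mem h with h | h
  · exact Set.disjoint_left.mp S.free.disjoint hc h
  · rw [← hcomap, ← hab] at h
    rcases hm.isPrime.mem_or_mem h with h | h
    · exact hg h
    · exact Set.disjoint_left.mp S.free.disjoint b.2 ((hcomap _).mp h)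

end Main

end LocalDual

theorem mainTheorem4 {K : Type*} [Field K] [CharZero K] (n : ℕ)
    (I : Ideal (MvPolynomial (Fin n) K))
    (data : ∀ p ∈ associatedPrimes (MvPolynomial (Fin n) K) (MvPolynomial (Fin n) K ⧸ I),
      LocalDual.DualData I p)
    (f : MvPolynomial (Fin n) K) :
    f ∈ I ↔
      ∀ (p : Ideal (MvPolynomial (Fin n) K))
        (hp : p ∈ associatedPrimes (MvPolynomial (Fin n) K) (MvPolynomial (Fin n) K ⧸ I)),
        ∀ D ∈ (data p hp).A, (data p hp).apply D f = 0 := by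
  refine ⟨fun hf p hp D hD => (data p hp).apply_eq_zero_of_mem hf hD, fun h => ?_⟩
  by_contra hf
  obtain ⟨p, hp, hle, s, hs, k, hk⟩ := LocalDual.exists_associatedPrime_of_notMem hf
  obtain ⟨r, hr, hrf⟩ := (data p hp).exists_notMem_mul_mem hp.isPrime hs hk (h p hp)
  exact hr (hle r hrf)
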